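/- Theorem 3 (Latent Dirichlet Allocation). Model. Let $\alpha\in\mathbb R^k$ ($k\ge 1$) have strictly positive entries, let $\alpha_0=\sum_{i=1}^k\alpha_i$, and let $O\in\mathbb R^{d\times k}$ be a matrix of rank $k$ (so $d\ge k$) each of whose columns $O_1,\dots,O_k$ is a probability distribution on $\{1,\dots,d\}$. The latent vector $h$ has the Dirichlet distribution with parameter $\alpha$, i.e. density $\frac{\Gamma(\alpha_0)}{\prod_i\Gamma(\alpha_i)}\prod_{i}h_i^{\alpha_i-1}$ on the probability simplex. Given $h$, independently for each $v=1,2,3,\dots$, a topic $z_v\in\{1,\dots,k\}$ is drawn from $h$, then a word in $\{1,\dots,d\}$ is drawn from the column $O_{z_v}$; $x_v\in\mathbb R^d$ is the one-hot encoding of that word. With $\mu=\mathbb E[x_1]$, set $$\mathrm{Pairs}_{\alpha_0}=\mathbb E[x_1x_2^\top]-\tfrac{\alpha_0}{\alpha_0+1}\mu\mu^\top,$$ $$\mathrm{Triples}_{\alpha_0}(\eta)=\mathbb E[x_1x_2^\top\langle\eta,x_3\rangle]-\tfrac{\alpha_0}{\alpha_0+2}\bigl(\mathbb E[x_1x_2^\top]\eta\mu^\top+\mu\eta^\top\mathbb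 E[x_1x_2^\top]+\langle\eta,\mu\rangle\mathbb E[x_1x_2^\top]\bigr)+\tfrac{2\alpha_0^2}{(\alpha_0+2)(\alpha_0+1)}\langle\eta,\mu\rangle\mu\mu^\top .$$ For a matrix $A$ with linearly independent columns write $A^+=(A^\top A)^{-1}A^\top$, and write $\vec 1$ for a vector of all ones. Algorithm. The input is $\theta\in\mathbb R^k$, $\mathrm{Pairs}_{\alpha_0}$ and $\mathrm{Triples}_{\alpha_0}$. (1) Find $U\in\mathbb R^{d\times k}$ with $\mathrm{Range}(U)=\mathrm{Range}(\mathrm{Pairs}_{\alpha_0})$. (2) Find $V\in\mathbb R^{k\times k}$ with $V^\top(U^\top\mathrm{Pairs}_{\alpha_0}U)V=I$ and set $W=UV$. (3) Compute a singular value decomposition of $W^\top\mathrm{Triples}_{\alpha_0}(W\theta)W$ and let $\Lambda$ be the set of its left singular vectors whose singular value is unique (of multiplicity one among the $k$ singular values). (4) Return the set $\widehat O=\bigl\{(W^+)^\top\lambda\,/\,(\vec 1^\top(W^+)^\top\lambda):\lambda\in\Lambda\bigr\}$. Claim. Every step of the algorithm can be carried out (in particular $W$ has linearly independent columns and the denominators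 in step 4 are nonzero), and: - (No false positives) For every $\theta\in\mathbb R^k$ and all choices made in steps 1--3, $\widehat O$ is a subset of the set $\{O_1,\dots,O_k\}$ of columns of $O$. - (Topic recovery) For every $U$ and $V$ as in steps 1 and 2 (chosen without reference to $\theta$), if $\theta$ is uniformly distributed on the unit sphere $S^{k-1}$, then with probability $1$, for every singular value decomposition in step 3, $\widehat O=\{O_1,\dots,O_k\}$. - (Parameter recovery) $\alpha=\alpha_0(\alpha_0+1)\,O^+\,\mathrm{Pairs}_{\alpha_0}\,(O^+)^\top\,\vec 1$. -/

import Mathlib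

open MeasureTheory Matrix

noncomputable section

namespace LDA

/-- The point `(1 - ∑ i, y i, y 0, …, y (m-1))` of the affine hyperplane of vectors in `ℝ^(m+1)`
with coordinate sum one, parametrized by its last `m` coordinates. -/
def simplexPoint {m : ℕ} (y : Fin m → ℝ) : Fin (m + 1) → ℝ :=
  Fin.cons (1 - ∑ i, y i) y

/-- The normalizing constant `Z(α) = (∏ i, Γ(α i)) / Γ(∑ i, α i)`. -/
def dirichletZ {k : ℕ} (α : Fin k → ℝ) : ℝ :=
  (∏ i, Real.Gamma (α i)) / Real.Gamma (∑ i, α i)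

/-- The Dirichlet distribution on the probability simplex of `ℝ^k`: its density with respect to
Lebesgue measure on the simplex (in the coordinates `simplexPoint`) is
`Z(α)⁻¹ * ∏ i, p i ^ (α i - 1)`. There is no Dirichlet distribution for `k = 0`, where the simplex
is empty; the value there is the zero measure. -/
def dirichlet : {k : ℕ} → (Fin k → ℝ) → Measure (Fin k → ℝ)
  | 0, _ => 0
  | m + 1, α =>
    (((volume : Measure (Fin m → ℝ)).restrict
        {y | simplexPoint y ∈ stdSimplex ℝ (Fin (m + 1))}).withDensity
      (fun y => ENNReal.ofReal ((dirichletZ α)⁻¹ * ∏ i, simplexPoint y i ^ (α i - 1)))).map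
      simplexPoint

/-- The latent Dirichlet allocation model. The topic mixture `h` is Dirichlet distributed; given
`h`, the pairs `(z v, w v)` of the topic and the word at position `v` are independent over `v`,
with `z v` drawn from `h` and then `w v` drawn from column `z v` of `O`. -/
structure IsModel {Ω : Type*} [MeasurableSpace Ω] (P : Measure Ω) {d k : ℕ}
    (α : Fin k → ℝ) (O : Matrix (Fin d) (Fin k) ℝ)
    (h : Ω → Fin k → ℝ) (z : ℕ → Ω → Fin k) (w : ℕ → Ω → Fin d) : Prop where
  measurable_h : Measurable h
  measurable_z : ∀ v, Measurable (z v)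
  measurable_w : ∀ v, Measurable (w v)
  law_h : P.map h = dirichlet α
  law_words : ∀ (n : ℕ) (B : Set (Fin k → ℝ)), MeasurableSet B →
    ∀ (i : Fin n → Fin k) (j : Fin n → Fin d),
      P {ω | h ω ∈ B ∧ ∀ v : Fin n, z v ω = i v ∧ w v ω = j v} =
        ∫⁻ p in B, ∏ v, ENNReal.ofReal (p (i v) * O (j v) (i v)) ∂(P.map h)

/-- The one-hot encoding of the word at position `v`. -/
def oneHot {Ω : Type*} {d : ℕ} (w : ℕ → Ω → Fin d) (v : ℕ) (ω : Ω) : Fin d → ℝ :=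
  Pi.single (w v ω) 1

section Moments

variable {Ω : Type*} [MeasurableSpace Ω] (P : Measure Ω) {d : ℕ} (x : ℕ → Ω → Fin d → ℝ)

/-- `μ = E[x₁]`; the observations `x₁, x₂, x₃, …` are `x 0, x 1, x 2, …`. -/
def mean : Fin d → ℝ := fun a => ∫ ω, x 0 ω a ∂P

/-- `E[x₁ x₂ᵀ]`. -/
def secondMoment : Matrix (Fin d) (Fin d) ℝ :=
  Matrix.of fun a b => ∫ ω, x 0 ω a * x 1 ω b ∂P

/-- `E[x₁ x₂ᵀ ⟨η, x₃⟩]`. -/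
def thirdMoment (η : Fin d → ℝ) : Matrix (Fin d) (Fin d) ℝ :=
  Matrix.of fun a b => ∫ ω, x 0 ω a * x 1 ω b * (η ⬝ᵥ x 2 ω) ∂P

/-- The modified second moment. -/
def pairs (α₀ : ℝ) : Matrix (Fin d) (Fin d) ℝ :=
  secondMoment P x - (α₀ / (α₀ + 1)) • vecMulVec (mean P x) (mean P x)

/-- The modified third moment, projected to a matrix. -/
def triples (α₀ : ℝ) (η : Fin d → ℝ) : Matrix (Fin d) (Fin d) ℝ :=
  thirdMoment P x η
    - (α₀ / (α₀ + 2)) •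
      (secondMoment P x * vecMulVec η (mean P x)
        + vecMulVec (mean P x) η * secondMoment P x
        + (η ⬝ᵥ mean P x) • secondMoment P x)
    + (2 * α₀ ^ 2 / ((α₀ + 2) * (α₀ + 1))) •
      ((η ⬝ᵥ mean P x) • vecMulVec (mean P x) (mean P x))

end Moments

section Algorithm

variable {d k : ℕ}

/-- The pseudo-inverse `A⁺ = (AᵀA)⁻¹Aᵀ` of a matrix with linearly independent columns. -/
def pinv (A : Matrix (Fin d) (Fin k) ℝ) : Matrix (Fin k) (Fin d) ℝ :=
  (Aᵀ * A)⁻¹ * Aᵀ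

/-- Step 1 (dimensionality reduction): `Range U = Range Pairs`. -/
def IsReduction (Pairs : Matrix (Fin d) (Fin d) ℝ) (U : Matrix (Fin d) (Fin k) ℝ) : Prop :=
  LinearMap.range U.mulVecLin = LinearMap.range Pairs.mulVecLin

/-- Step 2 (whitening): `Vᵀ (Uᵀ Pairs U) V` is the identity matrix. -/
def IsWhitening (Pairs : Matrix (Fin d) (Fin d) ℝ) (U : Matrix (Fin d) (Fin k) ℝ)
    (V : Matrix (Fin k) (Fin k) ℝ) : Prop :=
  Vᵀ * (Uᵀ * Pairs * U) * V = 1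

/-- `A = L diag(s) Rᵀ` is a singular value decomposition of the square matrix `A`. -/
structure IsSVD (A L : Matrix (Fin k) (Fin k) ℝ) (s : Fin k → ℝ)
    (R : Matrix (Fin k) (Fin k) ℝ) : Prop where
  left_orthogonal : L ∈ Matrix.orthogonalGroup (Fin k) ℝ
  right_orthogonal : R ∈ Matrix.orthogonalGroup (Fin k) ℝ
  nonneg : ∀ i, 0 ≤ s i
  eq : A = L * Matrix.diagonal s * Rᵀ

/-- The matrix `Wᵀ Triples(Wθ) W` decomposed in step 3. -/
def whitenedTriples (Triples : (Fin d → ℝ) → Matrix (Fin d) (Fin d) ℝ)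
    (W : Matrix (Fin d) (Fin k) ℝ) (θ : Fin k → ℝ) : Matrix (Fin k) (Fin k) ℝ :=
  Wᵀ * Triples (W *ᵥ θ) * W

/-- The set of left singular vectors (columns of `L`) with unique singular values. -/
def uniqueSingularVectors (L : Matrix (Fin k) (Fin k) ℝ) (s : Fin k → ℝ) : Set (Fin k → ℝ) :=
  {l | ∃ i, l = L.col i ∧ ∀ j, s j = s i → j = i}

/-- Step 4 (reconstruct and normalize): the set of the vectors `(W⁺)ᵀ l / (𝟏ᵀ (W⁺)ᵀ l)`, where `l`
ranges over the left singular vectors with unique singular values. -/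
def output (W : Matrix (Fin d) (Fin k) ℝ) (L : Matrix (Fin k) (Fin k) ℝ) (s : Fin k → ℝ) :
    Set (Fin d → ℝ) :=
  (fun l => ((1 : Fin d → ℝ) ⬝ᵥ ((pinv W)ᵀ *ᵥ l))⁻¹ • ((pinv W)ᵀ *ᵥ l)) ''
    uniqueSingularVectors L s

end Algorithm

/-- The uniform probability measure on the unit sphere of `ℝ^k`. -/
def uniformSphere (k : ℕ) : Measure (Metric.sphere (0 : EuclideanSpace ℝ (Fin k)) 1) :=
  ((volume : Measure (EuclideanSpace ℝ (Fin k))).toSphere Set.univ)⁻¹ •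
    (volume : Measure (EuclideanSpace ℝ (Fin k))).toSphere

end LDA

end

/-!
The Dirichlet density times a coordinate is again a multiple of a Dirichlet density, with one
parameter raised by one, so all moments of `h` follow from `Γ(a + 1) = a Γ(a)`. They give, with
`δ i ^ 2 = α i / (α₀ (α₀ + 1))`, `γ i = 2 / ((α₀ + 2) δ i)` and `A = O diag(δ)`, that
`Pairs = A Aᵀ` and `Triples(η) = A diag(γ * Aᵀη) Aᵀ`. Whitening makes `Q = WᵀA` orthogonal, hence
`Wᵀ Triples(Wθ) W = Q diag(γ * Qᵀθ) Qᵀ`: a left singular vector with unique singular value is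
proportional to a column of `Q`, which `(W⁺)ᵀ` maps to a column of `A`. All singular values are
unique unless `γ i ⟪Q i, θ⟫ = ± γ j ⟪Q j, θ⟫` for some `i ≠ j`, which places `θ` on one of finitely
many hyperplanes.
-/

namespace LDA

open scoped ENNReal

section DirichletIntegral

theorem lintegral_fin_prod_eq_prod {n : ℕ} {E : Fin n → Type*} [∀ i, MeasurableSpace (E i)]
    (μ : ∀ i, Measure (E i)) [∀ i, SigmaFinite (μ i)] {f : ∀ i, E i → ℝ≥0∞}
    (hf : ∀ i, Measurable (f i)) :
    ∫⁻ x, ∏ i, f i (x i) ∂Measure.pi μ = ∏ i, ∫⁻ t, f i t ∂μ i := by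
  induction n with
  | zero => simp
  | succ n ih =>
    have hf_tail : Measurable fun x : ∀ j : Fin n, E j.succ => ∏ j, f j.succ (x j) :=
      Finset.measurable_fun_prod _ fun j _ => (hf j.succ).comp (measurable_pi_apply j)
    rw [← (measurePreserving_piFinSuccAbove μ 0).symm.lintegral_comp_emb
      (MeasurableEquiv.measurableEmbedding _)]
    simp_rw [MeasurableEquiv.piFinSuccAbove_symm_apply, Fin.insertNthEquiv, Fin.prod_univ_succ,
      Equiv.coe_fn_mk, Fin.insertNth_zero]
    rw [← ih (fun j => μ j.succ) (fun j => hf j.succ)]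
    exact lintegral_prod_mul (ν := Measure.pi fun j => μ j.succ) (hf 0).aemeasurable
      hf_tail.aemeasurable

theorem lintegral_eq_ofReal_mul_lintegral_comp_smul {E : Type*} [NormedAddCommGroup E]
    [NormedSpace ℝ E] [MeasurableSpace E] [BorelSpace E] [FiniteDimensional ℝ E] (μ : Measure E)
    [μ.IsAddHaarMeasure] (f : E → ℝ≥0∞) {t : ℝ} (ht : t ≠ 0) :
    ∫⁻ x, f x ∂μ = ENNReal.ofReal |t ^ Module.finrank ℝ E| * ∫⁻ x, f (t • x) ∂μ := by
  rw [← (measurableEmbedding_const_smul₀ ht).lintegral_map, Measure.map_addHaar_smul _ ht,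
    lintegral_smul_measure, smul_eq_mul, ← mul_assoc, ← ENNReal.ofReal_mul (abs_nonneg _),
    ← abs_mul, mul_inv_cancel₀ (pow_ne_zero _ ht), abs_one, ENNReal.ofReal_one, one_mul]

theorem measurable_finCons {m : ℕ} :
    Measurable fun q : ℝ × (Fin m → ℝ) => (Fin.cons q.1 q.2 : Fin (m + 1) → ℝ) :=
  measurable_pi_lambda _ (Fin.cases measurable_fst fun j =>
    (measurable_pi_apply j).comp measurable_snd)

theorem lintegral_eq_lintegral_lintegral_cons_sub_sum {m : ℕ} {f : (Fin (m + 1) → ℝ) → ℝ≥0∞}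
    (hf : Measurable f) :
    ∫⁻ x, f x = ∫⁻ t : ℝ, ∫⁻ y : Fin m → ℝ, f (Fin.cons (t - ∑ i, y i) y) := by
  have hf_shear : Measurable fun q : (Fin m → ℝ) × ℝ => f (Fin.cons (q.2 - ∑ i, q.1 i) q.1) :=
    hf.comp (measurable_finCons.comp (by fun_prop :
      Measurable fun q : (Fin m → ℝ) × ℝ => (q.2 - ∑ i, q.1 i, q.1)))
  calc ∫⁻ x, f x = ∫⁻ q : ℝ × (Fin m → ℝ), f (Fin.cons q.1 q.2) := by
        rw [← (volume_preserving_piFinSuccAbove (fun _ => ℝ) 0).symm.lintegral_comp_emb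
          (MeasurableEquiv.measurableEmbedding _)]
        simp [Fin.insertNthEquiv]
    _ = ∫⁻ y : Fin m → ℝ, ∫⁻ s : ℝ, f (Fin.cons s y) :=
        lintegral_prod_symm _ (hf.comp measurable_finCons).aemeasurable
    _ = ∫⁻ y : Fin m → ℝ, ∫⁻ t : ℝ, f (Fin.cons (t - ∑ i, y i) y) :=
        lintegral_congr fun y =>
          (lintegral_sub_right_eq_self (fun s : ℝ => f (Fin.cons s y)) (∑ i, y i)).symm
    _ = ∫⁻ t : ℝ, ∫⁻ y : Fin m → ℝ, f (Fin.cons (t - ∑ i, y i) y) :=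
        lintegral_lintegral_swap hf_shear.aemeasurable

/-- The density `x ↦ x ^ (a - 1)` on `[0, ∞)`, extended by zero: a one-dimensional factor of the
unnormalized Dirichlet density. -/
noncomputable def powerDensity (a x : ℝ) : ℝ≥0∞ :=
  if 0 ≤ x then ENNReal.ofReal (x ^ (a - 1)) else 0

theorem powerDensity_of_nonneg {a x : ℝ} (hx : 0 ≤ x) :
    powerDensity a x = ENNReal.ofReal (x ^ (a - 1)) :=
  if_pos hx

theorem powerDensity_of_neg {a x : ℝ} (hx : x < 0) : powerDensity a x = 0 :=
  if_neg hx.not_ge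

@[fun_prop]
theorem measurable_powerDensity (a : ℝ) : Measurable (powerDensity a) :=
  Measurable.ite measurableSet_Ici (by fun_prop) measurable_const

theorem powerDensity_mul {a t : ℝ} (ht : 0 < t) (x : ℝ) :
    powerDensity a (t * x) = ENNReal.ofReal (t ^ (a - 1)) * powerDensity a x := by
  rcases le_or_gt 0 x with hx | hx
  · rw [powerDensity_of_nonneg (by positivity), powerDensity_of_nonneg hx,
      Real.mul_rpow ht.le hx, ENNReal.ofReal_mul (by positivity)]
  · rw [powerDensity_of_neg (mul_neg_of_pos_of_neg ht hx), powerDensity_of_neg hx, mul_zero]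

theorem ofReal_mul_powerDensity {a : ℝ} (ha : 0 < a) (x : ℝ) :
    ENNReal.ofReal x * powerDensity a x = powerDensity (a + 1) x := by
  rcases lt_trichotomy x 0 with hx | rfl | hx
  · simp [powerDensity_of_neg hx]
  · simp [powerDensity_of_nonneg, Real.zero_rpow ha.ne']
  · rw [powerDensity_of_nonneg hx.le, powerDensity_of_nonneg hx.le, ← ENNReal.ofReal_mul hx.le,
      Real.rpow_sub_one hx.ne', mul_div_cancel₀ _ hx.ne', add_sub_cancel_right]

theorem lintegral_powerDensity_mul_exp {a : ℝ} (ha : 0 < a) :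
    ∫⁻ x, powerDensity a x * ENNReal.ofReal (Real.exp (-x)) = ENNReal.ofReal (Real.Gamma a) := by
  have integrand_nonneg : ∀ x ∈ Set.Ioi (0 : ℝ), 0 ≤ Real.exp (-x) * x ^ (a - 1) :=
    fun x hx => mul_nonneg (Real.exp_pos _).le (Real.rpow_nonneg (le_of_lt hx) _)
  rw [Real.Gamma_eq_integral ha,
    ofReal_integral_eq_lintegral_ofReal (Real.GammaIntegral_convergent ha)
      (ae_restrict_of_forall_mem measurableSet_Ioi integrand_nonneg),
    setLIntegral_congr Ioi_ae_eq_Ici, ← lintegral_indicator measurableSet_Ici]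
  refine lintegral_congr fun x => ?_
  rcases le_or_gt 0 x with hx | hx
  · rw [powerDensity_of_nonneg hx, Set.indicator_of_mem (Set.mem_Ici.2 hx), mul_comm (Real.exp _),
      ENNReal.ofReal_mul (by positivity)]
  · rw [powerDensity_of_neg hx, Set.indicator_of_notMem (by simpa using hx), zero_mul]

/-- The unnormalized density `∏ i, p i ^ (α i - 1)` of the Dirichlet distribution, as a function on
all of `ℝ^ι` that vanishes outside the nonnegative orthant. -/
noncomputable def monomialDensity {ι : Type*} [Fintype ι] (α p : ι → ℝ) : ℝ≥0∞ :=
  ∏ i, powerDensity (α i) (p i)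

section MonomialDensity

variable {ι : Type*} [Fintype ι]

@[fun_prop]
theorem measurable_monomialDensity (α : ι → ℝ) : Measurable (monomialDensity α) :=
  Finset.measurable_fun_prod _ fun i _ => (measurable_powerDensity _).comp (measurable_pi_apply i)

theorem monomialDensity_of_nonneg {α p : ι → ℝ} (hp : ∀ i, 0 ≤ p i) :
    monomialDensity α p = ENNReal.ofReal (∏ i, p i ^ (α i - 1)) := by
  rw [ENNReal.ofReal_prod_of_nonneg fun i _ => Real.rpow_nonneg (hp i) _]
  exact Finset.prod_congr rfl fun i _ => powerDensity_of_nonneg (hp i)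

theorem monomialDensity_of_not_nonneg {α p : ι → ℝ} (hp : ¬ ∀ i, 0 ≤ p i) :
    monomialDensity α p = 0 := by
  obtain ⟨i, hi⟩ := not_forall.1 hp
  exact Finset.prod_eq_zero (Finset.mem_univ i) (powerDensity_of_neg (not_le.1 hi))

theorem monomialDensity_smul (α : ι → ℝ) {t : ℝ} (ht : 0 < t) (p : ι → ℝ) :
    monomialDensity α (t • p) =
      ENNReal.ofReal (t ^ (∑ i, α i - Fintype.card ι)) * monomialDensity α p := by
  have exponent : ∑ i, (α i - 1) = ∑ i, α i - Fintype.card ι := by simp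
  simp only [monomialDensity, Pi.smul_apply, smul_eq_mul, powerDensity_mul ht,
    Finset.prod_mul_distrib]
  rw [← ENNReal.ofReal_prod_of_nonneg fun i _ => by positivity, ← Real.rpow_sum_of_pos ht, exponent]

theorem monomialDensity_add_single [DecidableEq ι] {α : ι → ℝ} {i : ι} (hi : 0 < α i)
    (p : ι → ℝ) :
    monomialDensity (α + Pi.single i 1) p = ENNReal.ofReal (p i) * monomialDensity α p := by
  unfold monomialDensity
  rw [← Finset.mul_prod_erase _ _ (Finset.mem_univ i), ← Finset.mul_prod_erase _ _
    (Finset.mem_univ i), ← mul_assoc, ofReal_mul_powerDensity hi]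
  congr 1
  · simp
  · refine Finset.prod_congr rfl fun j hj => ?_
    simp [Finset.ne_of_mem_erase hj]

end MonomialDensity

theorem lintegral_monomialDensity_mul_exp {n : ℕ} {α : Fin n → ℝ} (hα : ∀ i, 0 < α i) :
    ∫⁻ x, monomialDensity α x * ENNReal.ofReal (Real.exp (-∑ i, x i)) =
      ∏ i, ENNReal.ofReal (Real.Gamma (α i)) := by
  have factor (x : Fin n → ℝ) : monomialDensity α x * ENNReal.ofReal (Real.exp (-∑ i, x i)) =
      ∏ i, powerDensity (α i) (x i) * ENNReal.ofReal (Real.exp (-x i)) := by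
    rw [Finset.prod_mul_distrib, ← Finset.sum_neg_distrib, Real.exp_sum,
      ENNReal.ofReal_prod_of_nonneg fun i _ => (Real.exp_pos _).le, monomialDensity]
  simp_rw [factor]
  rw [volume_pi, lintegral_fin_prod_eq_prod (fun _ => volume)
    (f := fun i t => powerDensity (α i) t * ENNReal.ofReal (Real.exp (-t))) (by fun_prop)]
  exact Finset.prod_congr rfl fun i _ => lintegral_powerDensity_mul_exp (hα i)

theorem measurable_simplexPoint {m : ℕ} : Measurable (simplexPoint (m := m)) :=
  measurable_finCons.comp (by fun_prop : Measurable fun y : Fin m → ℝ => (1 - ∑ i, y i, y))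

theorem smul_simplexPoint {m : ℕ} (t : ℝ) (y : Fin m → ℝ) :
    t • simplexPoint y = Fin.cons (t - ∑ i, (t • y) i) (t • y) := by
  ext i
  refine Fin.cases ?_ (fun j => ?_) i
  · simp [simplexPoint, mul_sub, Finset.mul_sum]
  · simp [simplexPoint]

theorem lintegral_monomialDensity_cons_sub_sum {m : ℕ} (α : Fin (m + 1) → ℝ) {t : ℝ}
    (ht : t ≠ 0) :
    ∫⁻ y, monomialDensity α (Fin.cons (t - ∑ i, y i) y) =
      powerDensity (∑ i, α i) t * ∫⁻ y, monomialDensity α (simplexPoint y) := by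
  rcases lt_or_gt_of_ne ht with ht | ht
  · rw [powerDensity_of_neg ht, zero_mul]
    refine (lintegral_congr fun y => monomialDensity_of_not_nonneg fun hy => ?_).trans
      lintegral_zero
    have hsum : (0 : ℝ) ≤ ∑ i, (Fin.cons (t - ∑ i, y i) y : Fin (m + 1) → ℝ) i :=
      Finset.sum_nonneg fun i _ => hy i
    rw [Fin.sum_cons, sub_add_cancel] at hsum
    exact hsum.not_gt ht
  · have exponent : t ^ m * t ^ (∑ i, α i - Fintype.card (Fin (m + 1))) =
        t ^ (∑ i, α i - 1) := by
      rw [← Real.rpow_natCast, ← Real.rpow_add ht, Fintype.card_fin, Nat.cast_succ]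
      congr 1
      ring
    rw [lintegral_eq_ofReal_mul_lintegral_comp_smul volume _ ht.ne', Module.finrank_fin_fun,
      abs_of_pos (by positivity)]
    simp_rw [← smul_simplexPoint, monomialDensity_smul α ht]
    rw [lintegral_const_mul' _ _ ENNReal.ofReal_ne_top, ← mul_assoc,
      ← ENNReal.ofReal_mul (by positivity), exponent, powerDensity_of_nonneg ht.le]

theorem Gamma_mul_lintegral_monomialDensity_simplexPoint {m : ℕ} {α : Fin (m + 1) → ℝ}
    (hα : ∀ i, 0 < α i) :
    ENNReal.ofReal (Real.Gamma (∑ i, α i)) * ∫⁻ y, monomialDensity α (simplexPoint y) =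
      ∏ i, ENNReal.ofReal (Real.Gamma (α i)) := by
  set J := ∫⁻ y, monomialDensity α (simplexPoint y)
  have hsum : 0 < ∑ i, α i := Finset.sum_pos (fun i _ => hα i) Finset.univ_nonempty
  calc ENNReal.ofReal (Real.Gamma (∑ i, α i)) * J
      = ∫⁻ t, powerDensity (∑ i, α i) t * ENNReal.ofReal (Real.exp (-t)) * J := by
        rw [lintegral_mul_const _ (by fun_prop), lintegral_powerDensity_mul_exp hsum]
    _ = ∫⁻ t : ℝ, ∫⁻ y : Fin m → ℝ, monomialDensity α (Fin.cons (t - ∑ i, y i) y) *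
          ENNReal.ofReal (Real.exp (-t)) := by
        refine lintegral_congr_ae ?_
        filter_upwards [Measure.ae_ne volume (0 : ℝ)] with t ht
        rw [lintegral_mul_const' _ _ ENNReal.ofReal_ne_top,
          lintegral_monomialDensity_cons_sub_sum α ht, mul_right_comm]
    _ = ∫⁻ x, monomialDensity α x * ENNReal.ofReal (Real.exp (-∑ i, x i)) := by
        rw [lintegral_eq_lintegral_lintegral_cons_sub_sum (by fun_prop)]
        simp [Fin.sum_cons]
    _ = ∏ i, ENNReal.ofReal (Real.Gamma (α i)) := lintegral_monomialDensity_mul_exp hα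

end DirichletIntegral

section DirichletDistribution

theorem simplexPoint_mem_stdSimplex_iff {m : ℕ} (y : Fin m → ℝ) :
    simplexPoint y ∈ stdSimplex ℝ (Fin (m + 1)) ↔ ∀ i, 0 ≤ simplexPoint y i :=
  ⟨fun h => h.1, fun h => ⟨h, by simp [simplexPoint, Fin.sum_cons]⟩⟩

theorem measurableSet_simplexPoint_mem_stdSimplex {m : ℕ} :
    MeasurableSet {y : Fin m → ℝ | simplexPoint y ∈ stdSimplex ℝ (Fin (m + 1))} :=
  measurable_simplexPoint (isClosed_stdSimplex ℝ _).measurableSet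

theorem dirichletZ_pos {k : ℕ} [NeZero k] {α : Fin k → ℝ} (hα : ∀ i, 0 < α i) :
    0 < dirichletZ α :=
  div_pos (Finset.prod_pos fun i _ => Real.Gamma_pos_of_pos (hα i))
    (Real.Gamma_pos_of_pos (Finset.sum_pos (fun i _ => hα i) Finset.univ_nonempty))

theorem add_single_one_pos {ι : Type*} [DecidableEq ι] {α : ι → ℝ} (hα : ∀ i, 0 < α i)
    (i j : ι) : 0 < (α + Pi.single i 1 : ι → ℝ) j := by
  rw [Pi.add_apply, Pi.single_apply]
  split_ifs <;> linarith [hα j]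

theorem sum_add_single_one {ι : Type*} [Fintype ι] [DecidableEq ι] (α : ι → ℝ) (i : ι) :
    ∑ j, (α + Pi.single i 1 : ι → ℝ) j = ∑ j, α j + 1 := by
  simp [Finset.sum_add_distrib]

theorem dirichletZ_add_single {k : ℕ} {α : Fin k → ℝ} (hα : ∀ i, 0 < α i) (i : Fin k) :
    dirichletZ (α + Pi.single i 1) = α i / (∑ j, α j) * dirichletZ α := by
  have hsum : 0 < ∑ i, α i := Finset.sum_pos (fun i _ => hα i) ⟨i, Finset.mem_univ i⟩
  have hprod : ∏ j, Real.Gamma ((α + Pi.single i 1 : Fin k → ℝ) j) =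
      α i * ∏ j, Real.Gamma (α j) := by
    rw [← Finset.mul_prod_erase _ _ (Finset.mem_univ i),
      ← Finset.mul_prod_erase _ _ (Finset.mem_univ i), ← mul_assoc,
      ← Real.Gamma_add_one (hα i).ne']
    congr 1
    · simp
    · exact Finset.prod_congr rfl fun j hj => by simp [Finset.ne_of_mem_erase hj]
  rw [dirichletZ, dirichletZ, hprod, sum_add_single_one, Real.Gamma_add_one hsum.ne',
    div_mul_div_comm]

theorem dirichlet_eq_smul_withDensity {m : ℕ} {α : Fin (m + 1) → ℝ} (hα : ∀ i, 0 < α i) :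
    dirichlet α = ENNReal.ofReal (dirichletZ α)⁻¹ •
      ((volume : Measure (Fin m → ℝ)).map simplexPoint).withDensity (monomialDensity α) := by
  have density_eq : {y : Fin m → ℝ | simplexPoint y ∈ stdSimplex ℝ (Fin (m + 1))}.indicator
      (fun y => ENNReal.ofReal ((dirichletZ α)⁻¹ * ∏ i, simplexPoint y i ^ (α i - 1))) =
      ENNReal.ofReal (dirichletZ α)⁻¹ • (monomialDensity α ∘ simplexPoint) := by
    ext y
    rw [Pi.smul_apply, smul_eq_mul, Function.comp_apply]
    by_cases hy : simplexPoint y ∈ stdSimplex ℝ (Fin (m + 1))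
    · rw [Set.indicator_of_mem (by exact hy), ENNReal.ofReal_mul
        (inv_nonneg.2 (dirichletZ_pos hα).le), monomialDensity_of_nonneg hy.1]
    · rw [Set.indicator_of_notMem (by exact hy), monomialDensity_of_not_nonneg
        (mt (simplexPoint_mem_stdSimplex_iff y).2 hy), mul_zero]
  rw [dirichlet, ← withDensity_indicator measurableSet_simplexPoint_mem_stdSimplex, density_eq,
    withDensity_smul _ ((measurable_monomialDensity α).comp measurable_simplexPoint),
    Measure.map_smul]
  congr 1
  ext s hs
  rw [Measure.map_apply measurable_simplexPoint hs, withDensity_apply _ hs,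
    withDensity_apply _ (measurable_simplexPoint hs),
    setLIntegral_map hs (measurable_monomialDensity α) measurable_simplexPoint]
  rfl

theorem isProbabilityMeasure_dirichlet {k : ℕ} [NeZero k] {α : Fin k → ℝ} (hα : ∀ i, 0 < α i) :
    IsProbabilityMeasure (dirichlet α) := by
  obtain _ | m := k
  · exact absurd rfl (NeZero.ne 0)
  have hΓ : 0 < Real.Gamma (∑ i, α i) :=
    Real.Gamma_pos_of_pos (Finset.sum_pos (fun i _ => hα i) Finset.univ_nonempty)
  have dirichlet_integral := Gamma_mul_lintegral_monomialDensity_simplexPoint hα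
  rw [← ENNReal.ofReal_prod_of_nonneg fun i _ => (Real.Gamma_pos_of_pos (hα i)).le,
    ← div_mul_cancel₀ (∏ i, _) hΓ.ne', ← dirichletZ, mul_comm (dirichletZ α),
    ENNReal.ofReal_mul hΓ.le, ENNReal.mul_right_inj (by simpa using hΓ) ENNReal.ofReal_ne_top]
    at dirichlet_integral
  constructor
  rw [dirichlet_eq_smul_withDensity hα, Measure.smul_apply, withDensity_apply _ .univ,
    setLIntegral_univ, lintegral_map (measurable_monomialDensity α) measurable_simplexPoint,
    dirichlet_integral, smul_eq_mul, ← ENNReal.ofReal_mul (inv_nonneg.2 (dirichletZ_pos hα).le),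
    inv_mul_cancel₀ (dirichletZ_pos hα).ne', ENNReal.ofReal_one]

theorem isFiniteMeasure_dirichlet {k : ℕ} {α : Fin k → ℝ} (hα : ∀ i, 0 < α i) :
    IsFiniteMeasure (dirichlet α) := by
  obtain _ | m := k
  · rw [dirichlet]
    infer_instance
  · have := isProbabilityMeasure_dirichlet hα
    infer_instance

theorem ae_mem_stdSimplex_dirichlet {k : ℕ} (α : Fin k → ℝ) :
    ∀ᵐ p ∂dirichlet α, p ∈ stdSimplex ℝ (Fin k) := by
  obtain _ | m := k
  · simp [dirichlet]
  · refine (ae_map_iff measurable_simplexPoint.aemeasurable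
      (isClosed_stdSimplex ℝ _).measurableSet).2 ?_
    exact (withDensity_absolutelyContinuous _ _).ae_le
      (ae_restrict_mem measurableSet_simplexPoint_mem_stdSimplex)

theorem integrable_dirichlet_of_continuous {k : ℕ} {α : Fin k → ℝ} (hα : ∀ i, 0 < α i)
    {f : (Fin k → ℝ) → ℝ} (hf : Continuous f) : Integrable f (dirichlet α) := by
  have := isFiniteMeasure_dirichlet hα
  rw [← Measure.restrict_eq_self_of_ae_mem (ae_mem_stdSimplex_dirichlet α)]
  exact hf.continuousOn.integrableOn_compact (isCompact_stdSimplex ℝ _)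

theorem withDensity_coord_dirichlet {k : ℕ} {α : Fin k → ℝ} (hα : ∀ i, 0 < α i) (i : Fin k) :
    (dirichlet α).withDensity (fun p => ENNReal.ofReal (p i)) =
      ENNReal.ofReal (α i / ∑ j, α j) • dirichlet (α + Pi.single i 1) := by
  obtain _ | m := k
  · exact i.elim0
  have hα_single := add_single_one_pos hα i
  have hmean : 0 < α i / ∑ j, α j :=
    div_pos (hα i) (Finset.sum_pos (fun j _ => hα j) Finset.univ_nonempty)
  have hdensity : monomialDensity (α + Pi.single i 1) =
      monomialDensity α * fun p => ENNReal.ofReal (p i) := by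
    ext p
    rw [monomialDensity_add_single (hα i), Pi.mul_apply, mul_comm]
  rw [dirichlet_eq_smul_withDensity hα, dirichlet_eq_smul_withDensity hα_single,
    withDensity_smul_measure, ← withDensity_mul _ (measurable_monomialDensity α) (by fun_prop),
    hdensity, dirichletZ_add_single hα, smul_smul, ← ENNReal.ofReal_mul hmean.le, mul_inv,
    mul_inv_cancel_left₀ hmean.ne']

theorem integral_coord_mul_dirichlet {k : ℕ} {α : Fin k → ℝ} (hα : ∀ i, 0 < α i) (i : Fin k)
    (f : (Fin k → ℝ) → ℝ) :
    ∫ p, p i * f p ∂dirichlet α =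
      α i / (∑ j, α j) * ∫ p, f p ∂dirichlet (α + Pi.single i 1) := by
  have hmean : 0 ≤ α i / ∑ j, α j :=
    div_nonneg (hα i).le (Finset.sum_nonneg fun j _ => (hα j).le)
  calc ∫ p, p i * f p ∂dirichlet α = ∫ p, (ENNReal.ofReal (p i)).toReal • f p ∂dirichlet α := by
        refine integral_congr_ae ?_
        filter_upwards [ae_mem_stdSimplex_dirichlet α] with p hp
        rw [ENNReal.toReal_ofReal (hp.1 i), smul_eq_mul]
    _ = ∫ p, f p ∂(dirichlet α).withDensity fun p => ENNReal.ofReal (p i) :=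
        (integral_withDensity_eq_integral_toReal_smul (by fun_prop)
          (.of_forall fun _ => ENNReal.ofReal_lt_top) f).symm
    _ = α i / (∑ j, α j) * ∫ p, f p ∂dirichlet (α + Pi.single i 1) := by
        rw [withDensity_coord_dirichlet hα, integral_smul_measure, ENNReal.toReal_ofReal hmean,
          smul_eq_mul]

end DirichletDistribution

section DirichletMoments

variable {k : ℕ} {α : Fin k → ℝ}

theorem integral_coord_dirichlet (hα : ∀ i, 0 < α i) (i : Fin k) :
    ∫ p, p i ∂dirichlet α = α i / ∑ j, α j := by
  have : NeZero k := ⟨i.pos.ne'⟩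
  have := isProbabilityMeasure_dirichlet (add_single_one_pos hα i)
  simpa using integral_coord_mul_dirichlet hα i 1

theorem integral_dotProduct_dirichlet (hα : ∀ i, 0 < α i) (β : Fin k → ℝ) :
    ∫ p, β ⬝ᵥ p ∂dirichlet α = (β ⬝ᵥ α) / ∑ i, α i := by
  simp only [dotProduct]
  rw [integral_finsetSum _ fun i _ => integrable_dirichlet_of_continuous hα (by fun_prop),
    Finset.sum_div]
  simp_rw [integral_const_mul, integral_coord_dirichlet hα, mul_div_assoc]

theorem mean_dirichlet (hα : ∀ i, 0 < α i) :
    mean (dirichlet α) (fun _ p => p) = (∑ i, α i)⁻¹ • α := by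
  ext i
  rw [mean, integral_coord_dirichlet hα, Pi.smul_apply, smul_eq_mul, div_eq_inv_mul]

theorem secondMoment_dirichlet (hα : ∀ i, 0 < α i) :
    secondMoment (dirichlet α) (fun _ p => p) =
      ((∑ i, α i) * (∑ i, α i + 1))⁻¹ • (vecMulVec α α + diagonal α) := by
  ext i j
  have : secondMoment (dirichlet α) (fun _ p => p) i j =
      α i / (∑ l, α l) * ((α + Pi.single i 1 : Fin k → ℝ) j / (∑ l, α l + 1)) := by
    rw [secondMoment, of_apply, integral_coord_mul_dirichlet hα i (fun p => p j),
      integral_coord_dirichlet (add_single_one_pos hα i), sum_add_single_one]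
  simp only [this, Matrix.smul_apply, Matrix.add_apply, vecMulVec_apply, Pi.add_apply, smul_eq_mul]
  rcases eq_or_ne i j with rfl | hij
  · rw [Pi.single_eq_same, diagonal_apply_eq]
    field_simp
  · rw [Pi.single_eq_of_ne' hij, diagonal_apply_ne _ hij, add_zero, add_zero]
    field_simp

theorem thirdMoment_dirichlet_apply (hα : ∀ i, 0 < α i) (β : Fin k → ℝ) (i j : Fin k) :
    thirdMoment (dirichlet α) (fun _ p => p) β i j =
      secondMoment (dirichlet α) (fun _ p => p) i j *
        ((β ⬝ᵥ α + β i + β j) / (∑ l, α l + 2)) := by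
  have hα_single := add_single_one_pos hα i
  simp only [thirdMoment, secondMoment, of_apply, mul_assoc]
  rw [integral_coord_mul_dirichlet hα i (fun p => p j * (β ⬝ᵥ p)),
    integral_coord_mul_dirichlet hα i (fun p => p j),
    integral_coord_mul_dirichlet hα_single j (fun p => β ⬝ᵥ p),
    integral_coord_dirichlet hα_single,
    integral_dotProduct_dirichlet (add_single_one_pos hα_single j), sum_add_single_one (α + _),
    sum_add_single_one, dotProduct_add, dotProduct_add, dotProduct_single_one,
    dotProduct_single_one, mul_assoc, add_assoc (∑ l, α l), one_add_one_eq_two]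

theorem pairs_dirichlet (hα : ∀ i, 0 < α i) :
    pairs (dirichlet α) (fun _ p => p) (∑ i, α i) =
      diagonal fun i => α i / ((∑ j, α j) * (∑ j, α j + 1)) := by
  ext i j
  have hsum : 0 < ∑ i, α i := Finset.sum_pos (fun i _ => hα i) ⟨i, Finset.mem_univ i⟩
  rw [pairs, secondMoment_dirichlet hα, mean_dirichlet hα]
  simp only [Matrix.sub_apply, Matrix.smul_apply, Matrix.add_apply, vecMulVec_apply, Pi.smul_apply,
    smul_eq_mul]
  rcases eq_or_ne i j with rfl | hij
  · rw [diagonal_apply_eq, diagonal_apply_eq]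
    field_simp
    ring
  · rw [diagonal_apply_ne _ hij, diagonal_apply_ne _ hij]
    field_simp
    ring

theorem secondMoment_dirichlet_mulVec (hα : ∀ i, 0 < α i) (β : Fin k → ℝ) :
    secondMoment (dirichlet α) (fun _ p => p) *ᵥ β =
      ((∑ i, α i) * (∑ i, α i + 1))⁻¹ • ((β ⬝ᵥ α) • α + α * β) := by
  ext i
  simp only [secondMoment_dirichlet hα, smul_mulVec, add_mulVec, vecMulVec_mulVec,
    dotProduct_comm α β, Pi.smul_apply, Pi.add_apply, Pi.mul_apply, mulVec_diagonal,
    op_smul_eq_smul]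

theorem vecMul_secondMoment_dirichlet (hα : ∀ i, 0 < α i) (β : Fin k → ℝ) :
    β ᵥ* secondMoment (dirichlet α) (fun _ p => p) =
      ((∑ i, α i) * (∑ i, α i + 1))⁻¹ • ((β ⬝ᵥ α) • α + α * β) := by
  rw [← secondMoment_dirichlet_mulVec hα, ← vecMul_transpose, secondMoment_dirichlet hα,
    transpose_smul, transpose_add, transpose_vecMulVec, diagonal_transpose]

theorem triples_dirichlet (hα : ∀ i, 0 < α i) (β : Fin k → ℝ) :
    triples (dirichlet α) (fun _ p => p) (∑ i, α i) β =
      diagonal fun i =>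
        2 * α i * β i / ((∑ j, α j) * (∑ j, α j + 1) * (∑ j, α j + 2)) := by
  ext i j
  have hsum : 0 < ∑ i, α i := Finset.sum_pos (fun i _ => hα i) ⟨i, Finset.mem_univ i⟩
  rw [triples, mul_vecMulVec, vecMulVec_mul, secondMoment_dirichlet_mulVec hα,
    vecMul_secondMoment_dirichlet hα]
  simp only [Matrix.add_apply, Matrix.sub_apply, Matrix.smul_apply, vecMulVec_apply,
    thirdMoment_dirichlet_apply hα, secondMoment_dirichlet hα, mean_dirichlet hα, dotProduct_smul,
    Pi.smul_apply, Pi.add_apply, Pi.mul_apply, smul_eq_mul]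
  rcases eq_or_ne i j with rfl | hij
  · rw [diagonal_apply_eq, diagonal_apply_eq]
    field_simp
    ring
  · rw [diagonal_apply_ne _ hij, diagonal_apply_ne _ hij]
    field_simp
    ring

end DirichletMoments

section LinearImageMoments

variable {Ω : Type*} [MeasurableSpace Ω] {μ : Measure Ω} {d k : ℕ}

theorem thirdMoment_apply_eq_sum {x : ℕ → Ω → Fin d → ℝ} {a b : Fin d}
    (hx : ∀ c, Integrable (fun ω => x 0 ω a * x 1 ω b * x 2 ω c) μ) (η : Fin d → ℝ) :
    thirdMoment μ x η a b = ∑ c, η c * ∫ ω, x 0 ω a * x 1 ω b * x 2 ω c ∂μ := by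
  simp only [thirdMoment, of_apply, dotProduct, Finset.mul_sum, mul_left_comm _ (η _)]
  rw [integral_finsetSum _ fun c _ => (hx c).const_mul (η c)]
  simp_rw [integral_const_mul]

theorem integral_mulVec_mul_mulVec_mul (A : Matrix (Fin d) (Fin k) ℝ) {f g : Ω → Fin k → ℝ}
    {c : Ω → ℝ} (hfgc : ∀ i j, Integrable (fun ω => f ω i * g ω j * c ω) μ) :
    (of fun a b => ∫ ω, (A *ᵥ f ω) a * (A *ᵥ g ω) b * c ω ∂μ) =
      A * (of fun i j => ∫ ω, f ω i * g ω j * c ω ∂μ) * Aᵀ := by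
  ext a b
  have expand (ω : Ω) : (A *ᵥ f ω) a * (A *ᵥ g ω) b * c ω =
      ∑ j, ∑ i, A a i * A b j * (f ω i * g ω j * c ω) := by
    rw [mulVec, mulVec, dotProduct, dotProduct, Finset.sum_mul_sum, Finset.sum_comm]
    simp only [Finset.sum_mul]
    exact Finset.sum_congr rfl fun j _ => Finset.sum_congr rfl fun i _ => by ring
  simp only [of_apply, Matrix.mul_apply, transpose_apply, expand, Finset.sum_mul]
  rw [integral_finsetSum _ fun j _ => integrable_finsetSum _ fun i _ => (hfgc i j).const_mul _]
  refine Finset.sum_congr rfl fun j _ => ?_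
  rw [integral_finsetSum _ fun i _ => (hfgc i j).const_mul _]
  exact Finset.sum_congr rfl fun i _ => by rw [integral_const_mul]; ring

variable (A : Matrix (Fin d) (Fin k) ℝ) {x : ℕ → Ω → Fin k → ℝ}

theorem mean_mulVec (hx : ∀ i, Integrable (fun ω => x 0 ω i) μ) :
    mean μ (fun v ω => A *ᵥ x v ω) = A *ᵥ mean μ x := by
  ext a
  simp only [mean, mulVec, dotProduct]
  rw [integral_finsetSum _ fun i _ => (hx i).const_mul _]
  simp_rw [integral_const_mul]

theorem secondMoment_mulVec (hx : ∀ i j, Integrable (fun ω => x 0 ω i * x 1 ω j) μ) :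
    secondMoment μ (fun v ω => A *ᵥ x v ω) = A * secondMoment μ x * Aᵀ := by
  have := integral_mulVec_mul_mulVec_mul A (c := 1) (by simpa using hx)
  simpa only [secondMoment, Pi.one_apply, mul_one] using this

theorem thirdMoment_mulVec
    (hx : ∀ i j β, Integrable (fun ω => x 0 ω i * x 1 ω j * (β ⬝ᵥ x 2 ω)) μ) (η : Fin d → ℝ) :
    thirdMoment μ (fun v ω => A *ᵥ x v ω) η = A * thirdMoment μ x (Aᵀ *ᵥ η) * Aᵀ := by
  rw [thirdMoment, thirdMoment, ← integral_mulVec_mul_mulVec_mul A fun i j => hx i j _]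
  simp_rw [dotProduct_mulVec, mulVec_transpose]

theorem pairs_mulVec (hx₁ : ∀ i, Integrable (fun ω => x 0 ω i) μ)
    (hx₂ : ∀ i j, Integrable (fun ω => x 0 ω i * x 1 ω j) μ) (α₀ : ℝ) :
    pairs μ (fun v ω => A *ᵥ x v ω) α₀ = A * pairs μ x α₀ * Aᵀ := by
  simp only [pairs, secondMoment_mulVec A hx₂, mean_mulVec A hx₁, Matrix.mul_sub, Matrix.sub_mul,
    Matrix.mul_smul, Matrix.smul_mul, mul_vecMulVec, vecMulVec_mul, vecMul_transpose]

theorem triples_mulVec (hx₁ : ∀ i, Integrable (fun ω => x 0 ω i) μ)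
    (hx₂ : ∀ i j, Integrable (fun ω => x 0 ω i * x 1 ω j) μ)
    (hx₃ : ∀ i j β, Integrable (fun ω => x 0 ω i * x 1 ω j * (β ⬝ᵥ x 2 ω)) μ)
    (α₀ : ℝ) (η : Fin d → ℝ) :
    triples μ (fun v ω => A *ᵥ x v ω) α₀ η = A * triples μ x α₀ (Aᵀ *ᵥ η) * Aᵀ := by
  have hη : η ⬝ᵥ A *ᵥ mean μ x = (Aᵀ *ᵥ η) ⬝ᵥ mean μ x := by
    rw [dotProduct_mulVec, mulVec_transpose]
  simp only [triples, thirdMoment_mulVec A hx₃, secondMoment_mulVec A hx₂, mean_mulVec A hx₁, hη,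
    Matrix.mul_add, Matrix.add_mul, Matrix.mul_sub, Matrix.sub_mul, Matrix.mul_smul,
    Matrix.smul_mul, mul_vecMulVec, vecMulVec_mul, ← mulVec_mulVec, ← vecMul_vecMul,
    vecMul_transpose, mulVec_transpose, Matrix.mul_assoc]

end LinearImageMoments

section WordMoments

theorem mulVec_nonneg_of_mem_stdSimplex {m n : Type*} [Fintype n] {A : Matrix m n ℝ}
    (hA : ∀ a i, 0 ≤ A a i) {p : n → ℝ} (hp : p ∈ stdSimplex ℝ n) (a : m) : 0 ≤ (A *ᵥ p) a :=
  Finset.sum_nonneg (f := fun i => A a i * p i) fun i _ => mul_nonneg (hA a i) (hp.1 i)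

theorem prod_oneHot_eq_indicator {Ω : Type*} {d n : ℕ} (w : ℕ → Ω → Fin d)
    (a : Fin n → Fin d) :
    (fun ω => ∏ v : Fin n, oneHot w v ω (a v)) =
      {ω | ∀ v : Fin n, w v ω = a v}.indicator 1 := by
  ext ω
  simp [oneHot, Pi.single_apply, Finset.prod_ite_zero, Set.indicator_apply, eq_comm]

variable {Ω : Type*} [MeasurableSpace Ω] {P : Measure Ω} {d k : ℕ}
  {α : Fin k → ℝ} {O : Matrix (Fin d) (Fin k) ℝ}
  {h : Ω → Fin k → ℝ} {z : ℕ → Ω → Fin k} {w : ℕ → Ω → Fin d}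

theorem IsModel.measure_words (hm : IsModel P α O h z w) (hO : ∀ a i, 0 ≤ O a i) {n : ℕ}
    (a : Fin n → Fin d) :
    P {ω | ∀ v : Fin n, w v ω = a v} =
      ∫⁻ p, ENNReal.ofReal (∏ v, (O *ᵥ p) (a v)) ∂dirichlet α := by
  set ζ : Ω → Fin n → Fin k := fun ω v => z v ω
  have hζ (i : Fin n → Fin k) : MeasurableSet (ζ ⁻¹' {i}) :=
    measurable_pi_lambda ζ (fun v => hm.measurable_z v) (measurableSet_singleton i)
  have law_topics_words (i : Fin n → Fin k) :
      P (ζ ⁻¹' {i} ∩ {ω | ∀ v : Fin n, w v ω = a v}) =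
        ∫⁻ p, ∏ v, ENNReal.ofReal (p (i v) * O (a v) (i v)) ∂dirichlet α := by
    rw [← hm.law_h, ← setLIntegral_univ, ← hm.law_words n .univ .univ]
    congr 1
    ext ω
    simp [ζ, funext_iff, forall_and]
  have integrand_eq {p : Fin k → ℝ} (hp : p ∈ stdSimplex ℝ (Fin k)) :
      ∑ i : Fin n → Fin k, ∏ v, ENNReal.ofReal (p (i v) * O (a v) (i v)) =
        ENNReal.ofReal (∏ v, (O *ᵥ p) (a v)) := by
    have hOp (v : Fin n) (i : Fin k) : 0 ≤ p i * O (a v) i := mul_nonneg (hp.1 i) (hO _ _)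
    have prod_sum := Finset.prod_univ_sum (fun _ : Fin n => Finset.univ)
      fun v i => ENNReal.ofReal (p i * O (a v) i)
    rw [Fintype.piFinset_univ] at prod_sum
    rw [← prod_sum, ENNReal.ofReal_prod_of_nonneg fun v _ =>
      mulVec_nonneg_of_mem_stdSimplex hO hp (a v)]
    refine Finset.prod_congr rfl fun v _ => ?_
    rw [← ENNReal.ofReal_sum_of_nonneg fun i _ => hOp v i]
    simp_rw [mulVec, dotProduct, mul_comm]
  calc P {ω | ∀ v : Fin n, w v ω = a v}
      = ∑ i, P (ζ ⁻¹' {i} ∩ {ω | ∀ v : Fin n, w v ω = a v}) := by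
        simp_rw [← Measure.restrict_apply (hζ _),
          sum_measure_preimage_singleton Finset.univ fun i _ => hζ i]
        simp
    _ = ∫⁻ p, ∑ i : Fin n → Fin k, ∏ v, ENNReal.ofReal (p (i v) * O (a v) (i v)) ∂dirichlet α := by
        simp_rw [law_topics_words]
        rw [lintegral_finsetSum _ fun i _ => by fun_prop]
    _ = ∫⁻ p, ENNReal.ofReal (∏ v, (O *ᵥ p) (a v)) ∂dirichlet α :=
        lintegral_congr_ae ((ae_mem_stdSimplex_dirichlet α).mono fun p hp => integrand_eq hp)

theorem measurableSet_words_eq (hw : ∀ v, Measurable (w v)) {n : ℕ} (a : Fin n → Fin d) :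
    MeasurableSet {ω | ∀ v : Fin n, w v ω = a v} := by
  simp only [Set.ofPred_forall]
  exact .iInter fun v => hw v (measurableSet_singleton (a v))

theorem integrable_prod_oneHot [IsFiniteMeasure P] (hw : ∀ v, Measurable (w v)) {n : ℕ}
    (a : Fin n → Fin d) : Integrable (fun ω => ∏ v : Fin n, oneHot w v ω (a v)) P := by
  rw [prod_oneHot_eq_indicator]
  exact (integrable_const 1).indicator (measurableSet_words_eq hw a)

theorem IsModel.integral_prod_oneHot (hm : IsModel P α O h z w) (hO : ∀ a i, 0 ≤ O a i)
    {n : ℕ} (a : Fin n → Fin d) :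
    ∫ ω, ∏ v : Fin n, oneHot w v ω (a v) ∂P = ∫ p, ∏ v, (O *ᵥ p) (a v) ∂dirichlet α := by
  have prod_nonneg : ∀ᵐ p ∂dirichlet α, 0 ≤ ∏ v, (O *ᵥ p) (a v) :=
    (ae_mem_stdSimplex_dirichlet α).mono fun p hp => Finset.prod_nonneg fun v _ =>
      mulVec_nonneg_of_mem_stdSimplex hO hp (a v)
  have prod_measurable : Measurable fun p => ∏ v, (O *ᵥ p) (a v) := by
    fun_prop
  rw [integral_eq_lintegral_of_nonneg_ae prod_nonneg prod_measurable.aestronglyMeasurable,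
    ← hm.measure_words hO, prod_oneHot_eq_indicator,
    integral_indicator_one (measurableSet_words_eq hm.measurable_w a), measureReal_def]

theorem IsModel.mean_eq (hm : IsModel P α O h z w) (hO : ∀ a i, 0 ≤ O a i) :
    mean P (oneHot w) = mean (dirichlet α) fun _ p => O *ᵥ p := by
  ext a
  simpa [mean] using hm.integral_prod_oneHot hO ![a]

theorem IsModel.secondMoment_eq (hm : IsModel P α O h z w) (hO : ∀ a i, 0 ≤ O a i) :
    secondMoment P (oneHot w) = secondMoment (dirichlet α) fun _ p => O *ᵥ p := by
  ext a b
  simpa [secondMoment, Fin.prod_univ_two] using hm.integral_prod_oneHot hO ![a, b]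

theorem IsModel.thirdMoment_eq [IsFiniteMeasure P] (hm : IsModel P α O h z w)
    (hα : ∀ i, 0 < α i) (hO : ∀ a i, 0 ≤ O a i) :
    thirdMoment P (oneHot w) = thirdMoment (dirichlet α) fun _ p => O *ᵥ p := by
  ext η a b
  rw [thirdMoment_apply_eq_sum fun c => by
      simpa [Fin.prod_univ_three] using integrable_prod_oneHot (P := P) hm.measurable_w ![a, b, c],
    thirdMoment_apply_eq_sum fun c => integrable_dirichlet_of_continuous hα (by fun_prop)]
  refine Finset.sum_congr rfl fun c _ => ?_
  simpa [Fin.prod_univ_three] using congrArg (η c * ·) (hm.integral_prod_oneHot hO ![a, b, c])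

theorem IsModel.pairs_eq (hm : IsModel P α O h z w) (hα : ∀ i, 0 < α i) (hO : ∀ a i, 0 ≤ O a i) :
    pairs P (oneHot w) (∑ i, α i) =
      O * diagonal (fun i => α i / ((∑ j, α j) * (∑ j, α j + 1))) * Oᵀ := by
  rw [pairs, hm.secondMoment_eq hO, hm.mean_eq hO, ← pairs,
    pairs_mulVec O (fun i => integrable_dirichlet_of_continuous hα (by fun_prop))
      (fun i j => integrable_dirichlet_of_continuous hα (by fun_prop)), pairs_dirichlet hα]

theorem IsModel.triples_eq [IsFiniteMeasure P] (hm : IsModel P α O h z w) (hα : ∀ i, 0 < α i)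
    (hO : ∀ a i, 0 ≤ O a i) (η : Fin d → ℝ) :
    triples P (oneHot w) (∑ i, α i) η =
      O * diagonal (fun i => 2 * α i * (Oᵀ *ᵥ η) i /
        ((∑ j, α j) * (∑ j, α j + 1) * (∑ j, α j + 2))) * Oᵀ := by
  rw [triples, hm.thirdMoment_eq hα hO, hm.secondMoment_eq hO, hm.mean_eq hO, ← triples,
    triples_mulVec O (fun i => integrable_dirichlet_of_continuous hα (by fun_prop))
      (fun i j => integrable_dirichlet_of_continuous hα (by fun_prop))
      (fun i j β => integrable_dirichlet_of_continuous hα (by fun_prop)), triples_dirichlet hα]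

end WordMoments

section RangeAndPseudoInverse

variable {m n : Type*} [Fintype m] [Fintype n]

theorem range_mulVecLin_mul_transpose_self (A : Matrix m n ℝ) :
    LinearMap.range (A * Aᵀ).mulVecLin = LinearMap.range A.mulVecLin := by
  refine Submodule.eq_of_le_of_finrank_eq ?_ (rank_self_mul_transpose A)
  rw [mulVecLin_mul]
  exact LinearMap.range_comp_le_range _ _

theorem isUnit_det_transpose_mul_of_range_eq [DecidableEq n] {A B : Matrix m n ℝ}
    (hA : A.rank = Fintype.card n)
    (hB : LinearMap.range B.mulVecLin = LinearMap.range A.mulVecLin) : IsUnit (Aᵀ * B).det := by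
  rw [← isUnit_iff_isUnit_det, ← mulVec_surjective_iff_isUnit, ← coe_mulVecLin,
    ← LinearMap.range_eq_top, mulVecLin_mul, LinearMap.range_comp, hB, ← LinearMap.range_comp,
    ← mulVecLin_mul]
  refine Submodule.eq_top_of_finrank_eq ?_
  rw [← Matrix.rank, rank_transpose_mul_self, hA, Module.finrank_fintype_fun_eq_card]

variable {d k : ℕ} {A : Matrix (Fin d) (Fin k) ℝ}

theorem isUnit_det_transpose_mul_self (hA : A.rank = k) : IsUnit (Aᵀ * A).det :=
  isUnit_det_transpose_mul_of_range_eq (by rwa [Fintype.card_fin]) rfl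

theorem pinv_mul_self (hA : A.rank = k) : pinv A * A = 1 := by
  rw [pinv, Matrix.mul_assoc, nonsing_inv_mul _ (isUnit_det_transpose_mul_self hA)]

theorem pinv_mul_mul_mul_transpose_pinv (hA : A.rank = k) (D : Matrix (Fin k) (Fin k) ℝ) :
    pinv A * (A * D * Aᵀ) * (pinv A)ᵀ = D := by
  calc pinv A * (A * D * Aᵀ) * (pinv A)ᵀ
      = (pinv A * A) * D * (pinv A * A)ᵀ := by simp only [transpose_mul, Matrix.mul_assoc]
    _ = D := by rw [pinv_mul_self hA, transpose_one, Matrix.one_mul, Matrix.mul_one]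

theorem transpose_pinv_mul_transpose (A : Matrix (Fin d) (Fin k) ℝ) :
    (pinv A)ᵀ * Aᵀ = A * pinv A := by
  simp only [pinv, transpose_mul, transpose_nonsing_inv, transpose_transpose, Matrix.mul_assoc]

theorem transpose_pinv_mul_transpose_mulVec (hA : A.rank = k) {v : Fin d → ℝ}
    (hv : v ∈ LinearMap.range A.mulVecLin) : ((pinv A)ᵀ * Aᵀ) *ᵥ v = v := by
  obtain ⟨u, rfl⟩ := hv
  rw [transpose_pinv_mul_transpose, mulVecLin_apply, mulVec_mulVec, Matrix.mul_assoc,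
    pinv_mul_self hA, Matrix.mul_one]

theorem exists_isWhitening_mul_transpose {U : Matrix (Fin d) (Fin k) ℝ}
    (hU : IsUnit (Aᵀ * U).det) : ∃ V, IsWhitening (A * Aᵀ) U V := by
  refine ⟨(Aᵀ * U)⁻¹, ?_⟩
  have gram : Uᵀ * (A * Aᵀ) * U = (Aᵀ * U)ᵀ * (Aᵀ * U) := by
    simp only [transpose_mul, transpose_transpose, Matrix.mul_assoc]
  rw [IsWhitening, gram, ← Matrix.mul_assoc, ← transpose_mul, mul_nonsing_inv _ hU,
    transpose_one, Matrix.one_mul, mul_nonsing_inv _ hU]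

end RangeAndPseudoInverse

section OrthogonalEigenbasis

theorem col_eq_smul_single_of_row_eq_smul_single {n F : Type*} [Fintype n] [DecidableEq n]
    [Field F] {G : Matrix n n F} (hG : G * Gᵀ = 1) {i j : n} {c : F}
    (hrow : G.row i = c • Pi.single j 1) : c ≠ 0 ∧ G.col j = c⁻¹ • Pi.single i 1 := by
  have smul_col : c • G.col j = Pi.single i 1 := by
    calc c • G.col j = G *ᵥ G.row i := by rw [hrow, mulVec_smul, mulVec_single_one]
      _ = (G * Gᵀ) *ᵥ Pi.single i 1 := by rw [← mulVec_mulVec, mulVec_single_one, col_transpose]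
      _ = Pi.single i 1 := by rw [hG, one_mulVec]
  have hc : c ≠ 0 := by
    rintro rfl
    simpa using congrFun smul_col i
  exact ⟨hc, by rw [← smul_col, inv_smul_smul₀ hc]⟩

theorem exists_apply_ne_zero_of_mul_eq_one {n F : Type*} [Fintype n] [DecidableEq n]
    [NonAssocSemiring F] [Nontrivial F] {G H : Matrix n n F} (h : G * H = 1) (i : n) :
    ∃ j, G i j ≠ 0 := by
  by_contra! row_eq_zero
  have := congrFun₂ h i i
  simp [Matrix.mul_apply, row_eq_zero] at this

variable {k : ℕ} {A Q L R : Matrix (Fin k) (Fin k) ℝ} {s t : Fin k → ℝ}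

theorem exists_isSVD_of_orthogonal (hQ : Q ∈ orthogonalGroup (Fin k) ℝ) (t : Fin k → ℝ) :
    ∃ L s R, IsSVD (Q * diagonal t * Qᵀ) L s R := by
  set σ : Fin k → ℝ := fun i => if 0 ≤ t i then 1 else -1 with hσ
  have σ_sq : diagonal σ * (diagonal σ)ᵀ = 1 := by
    rw [diagonal_transpose, diagonal_mul_diagonal, ← diagonal_one]
    congr 1 with i
    simp only [hσ]
    split_ifs <;> norm_num
  have abs_mul_σ : diagonal (fun i => |t i|) * diagonal σ = diagonal t := by
    rw [diagonal_mul_diagonal]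
    congr 1 with i
    simp only [hσ]
    split_ifs with hi
    · rw [abs_of_nonneg hi, mul_one]
    · rw [abs_of_neg (not_le.1 hi), mul_neg_one, neg_neg]
  refine ⟨Q, fun i => |t i|, Q * diagonal σ, hQ,
    mul_mem hQ ((mem_orthogonalGroup_iff _ _).2 σ_sq), fun i => abs_nonneg _, ?_⟩
  rw [transpose_mul, diagonal_transpose, ← abs_mul_σ]
  simp only [Matrix.mul_assoc]

theorem IsSVD.mul_transpose_mul_left (h : IsSVD A L s R) :
    A * Aᵀ * L = L * diagonal (s ^ 2) := by
  have hL := (mem_orthogonalGroup_iff' _ _).1 h.left_orthogonal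
  have hR := (mem_orthogonalGroup_iff' _ _).1 h.right_orthogonal
  calc A * Aᵀ * L = L * diagonal s * (Rᵀ * R) * diagonal s * (Lᵀ * L) := by
        rw [h.eq]
        simp only [transpose_mul, diagonal_transpose, transpose_transpose, Matrix.mul_assoc]
    _ = L * diagonal (s ^ 2) := by
        rw [hR, hL, Matrix.mul_one, Matrix.mul_one, Matrix.mul_assoc, ← sq, diagonal_pow]

theorem IsSVD.sq_eq_sq (hQ : Q ∈ orthogonalGroup (Fin k) ℝ)
    (h : IsSVD (Q * diagonal t * Qᵀ) L s R) {i j : Fin k} (hij : (Qᵀ * L) i j ≠ 0) :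
    t i ^ 2 = s j ^ 2 := by
  have hQ' := (mem_orthogonalGroup_iff' _ _).1 hQ
  have commute : diagonal (t ^ 2) * (Qᵀ * L) = Qᵀ * L * diagonal (s ^ 2) := by
    calc diagonal (t ^ 2) * (Qᵀ * L)
        = (Qᵀ * Q) * diagonal t * (Qᵀ * Q) * diagonal t * (Qᵀ * L) := by
          rw [hQ', Matrix.one_mul, Matrix.mul_one, ← sq, diagonal_pow]
      _ = Qᵀ * (Q * diagonal t * Qᵀ * (Q * diagonal t * Qᵀ)ᵀ * L) := by
          simp only [transpose_mul, diagonal_transpose, transpose_transpose, Matrix.mul_assoc]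
      _ = Qᵀ * L * diagonal (s ^ 2) := by rw [h.mul_transpose_mul_left, Matrix.mul_assoc]
  have entry := congrFun₂ commute i j
  rw [diagonal_mul, mul_diagonal, mul_comm] at entry
  exact mul_left_cancel₀ hij entry

theorem IsSVD.exists_col_eq_smul (hQ : Q ∈ orthogonalGroup (Fin k) ℝ)
    (h : IsSVD (Q * diagonal t * Qᵀ) L s R) {j : Fin k} (hj : ∀ j', s j' = s j → j' = j) :
    ∃ i, ∃ c : ℝ, c ≠ 0 ∧ L.col j = c • Q.col i ∧ t i ^ 2 = s j ^ 2 := by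
  have hQ' := (mem_orthogonalGroup_iff _ _).1 hQ
  have hG : Qᵀ * L ∈ orthogonalGroup (Fin k) ℝ := mul_mem (Unitary.star_mem hQ) h.left_orthogonal
  obtain ⟨i, hi⟩ := exists_apply_ne_zero_of_mul_eq_one ((mem_orthogonalGroup_iff' _ _).1 hG) j
  rw [transpose_apply] at hi
  have hrow : (Qᵀ * L).row i = (Qᵀ * L) i j • Pi.single j 1 := by
    ext j'
    rcases eq_or_ne j' j with rfl | hne
    · simp
    · suffices (Qᵀ * L) i j' = 0 by simp [this, hne]
      by_contra hij'
      refine hne (hj j' ?_)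
      rw [← sq_eq_sq₀ (h.nonneg _) (h.nonneg _), ← h.sq_eq_sq hQ hij', h.sq_eq_sq hQ hi]
  obtain ⟨hc, hcol⟩ := col_eq_smul_single_of_row_eq_smul_single
    ((mem_orthogonalGroup_iff _ _).1 hG) hrow
  refine ⟨i, _, inv_ne_zero hc, ?_, h.sq_eq_sq hQ hi⟩
  calc L.col j = (Q * (Qᵀ * L)).col j := by rw [← Matrix.mul_assoc, hQ', Matrix.one_mul]
    _ = Q *ᵥ (Qᵀ * L).col j := rfl
    _ = _ := by rw [hcol, mulVec_smul, mulVec_single_one]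

theorem IsSVD.exists_unique_col_eq_smul (hQ : Q ∈ orthogonalGroup (Fin k) ℝ)
    (h : IsSVD (Q * diagonal t * Qᵀ) L s R) (ht : Function.Injective fun i => t i ^ 2)
    (i : Fin k) :
    ∃ j, (∀ j', s j' = s j → j' = j) ∧ ∃ c : ℝ, c ≠ 0 ∧ L.col j = c • Q.col i := by
  have hG : Qᵀ * L ∈ orthogonalGroup (Fin k) ℝ := mul_mem (Unitary.star_mem hQ) h.left_orthogonal
  choose σ hσ using exists_apply_ne_zero_of_mul_eq_one ((mem_orthogonalGroup_iff _ _).1 hG)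
  have t_sq_eq (i : Fin k) : t i ^ 2 = s (σ i) ^ 2 := h.sq_eq_sq hQ (hσ i)
  have σ_injective : Function.Injective σ := fun i i' hi => ht (by simp only [t_sq_eq, hi])
  have σ_surjective : Function.Surjective σ := Finite.surjective_of_injective σ_injective
  have s_σ_unique (j' : Fin k) (hj' : s j' = s (σ i)) : j' = σ i := by
    obtain ⟨i', rfl⟩ := σ_surjective j'
    exact congrArg σ (ht (by simp only [t_sq_eq, hj']))
  obtain ⟨i', c, hc, hcol, hi'⟩ := h.exists_col_eq_smul hQ s_σ_unique
  obtain rfl : i' = i := ht (hi'.trans (t_sq_eq i).symm)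
  exact ⟨σ i', s_σ_unique, c, hc, hcol⟩

end OrthogonalEigenbasis

section Sphere

theorem ae_toSphere_notMem_of_ne_top {E : Type*} [NormedAddCommGroup E] [NormedSpace ℝ E]
    [FiniteDimensional ℝ E] [MeasurableSpace E] [BorelSpace E] (μ : Measure E)
    [μ.IsAddHaarMeasure] {s : Submodule ℝ E} (hs : s ≠ ⊤) :
    ∀ᵐ θ ∂μ.toSphere, θ.1 ∉ s := by
  have measurable_s : MeasurableSet {θ : Metric.sphere (0 : E) 1 | (θ : E) ∈ s} :=
    s.closed_of_finiteDimensional.measurableSet.preimage measurable_subtype_coe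
  simp only [ae_iff, not_not]
  rw [Measure.toSphere_apply' _ measurable_s]
  refine mul_eq_zero_of_right _ (measure_mono_null ?_ (Measure.addHaar_submodule μ s hs))
  rintro _ ⟨r, -, _, ⟨θ, hθ, rfl⟩, rfl⟩
  exact s.smul_mem r hθ

variable {k : ℕ}

theorem ae_uniformSphere_dotProduct_ne_zero {c : Fin k → ℝ} (hc : c ≠ 0) :
    ∀ᵐ θ ∂uniformSphere k, c ⬝ᵥ θ.1.ofLp ≠ 0 := by
  let φ : EuclideanSpace ℝ (Fin k) →ₗ[ℝ] ℝ :=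
    dotProductBilin ℝ ℝ c ∘ₗ (WithLp.linearEquiv 2 ℝ (Fin k → ℝ)).toLinearMap
  have ker_ne_top : LinearMap.ker φ ≠ ⊤ := fun htop =>
    hc (dotProduct_self_eq_zero.1
      (LinearMap.mem_ker.1 (htop ▸ Submodule.mem_top : WithLp.toLp 2 c ∈ LinearMap.ker φ)))
  exact Measure.ae_smul_measure (ae_toSphere_notMem_of_ne_top volume ker_ne_top) _

theorem ae_uniformSphere_injective_sq_mulVec {n : Type*} [Finite n] {C : Matrix n (Fin k) ℝ}
    (hC : LinearIndependent ℝ C.row) :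
    ∀ᵐ θ ∂uniformSphere k, Function.Injective fun i => (C *ᵥ θ.1.ofLp) i ^ 2 := by
  have row_add_smul_ne_zero {i j : n} (hij : i ≠ j) (r : ℝ) : C i + r • C j ≠ 0 := fun h0 =>
    one_ne_zero ((LinearIndepOn.pair_iff C.row hij).1 (hC.linearIndepOn _) 1 r
      (by rwa [one_smul])).1
  have ae_ne : ∀ᵐ θ ∂uniformSphere k, ∀ i j, i ≠ j →
      (C i + (1 : ℝ) • C j) ⬝ᵥ θ.1.ofLp ≠ 0 ∧ (C i + (-1 : ℝ) • C j) ⬝ᵥ θ.1.ofLp ≠ 0 := by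
    simp only [ae_all_iff]
    exact fun i j hij => (ae_uniformSphere_dotProduct_ne_zero (row_add_smul_ne_zero hij _)).and
      (ae_uniformSphere_dotProduct_ne_zero (row_add_smul_ne_zero hij _))
  filter_upwards [ae_ne] with θ hθ i j hij
  by_contra hne
  obtain ⟨add_ne, sub_ne⟩ := hθ i j hne
  simp only [add_dotProduct, smul_dotProduct, smul_eq_mul, one_mul, neg_mul] at add_ne sub_ne
  rcases sq_eq_sq_iff_eq_or_eq_neg.1 hij with h | h
  · exact sub_ne (by rw [← sub_eq_add_neg]; exact sub_eq_zero.2 h)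
  · exact add_ne (eq_neg_iff_add_eq_zero.1 h)

end Sphere

theorem col_mul_diagonal {m n R : Type*} [Fintype n] [DecidableEq n] [CommSemiring R]
    (O : Matrix m n R) (δ : n → R) (i : n) : (O * diagonal δ).col i = δ i • O.col i := by
  ext a
  rw [col_apply, mul_diagonal, mul_comm, Pi.smul_apply, col_apply, smul_eq_mul]

/-- The rescaling of a vector to coordinate sum one, as in step 4 of the algorithm; a vector with
coordinate sum zero is sent to `0`. -/
noncomputable def sumNormalize {m : Type*} [Fintype m] (v : m → ℝ) : m → ℝ :=
  ((1 : m → ℝ) ⬝ᵥ v)⁻¹ • v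

section SumNormalize

variable {m n : Type*} [Fintype m] [Fintype n]

theorem sumNormalize_smul {c : ℝ} (hc : c ≠ 0) (v : m → ℝ) :
    sumNormalize (c • v) = sumNormalize v := by
  rw [sumNormalize, sumNormalize, dotProduct_smul, smul_smul, smul_eq_mul, _root_.mul_inv_rev,
    inv_mul_cancel_right₀ hc]

theorem sumNormalize_of_mem_stdSimplex {v : m → ℝ} (hv : v ∈ stdSimplex ℝ m) :
    sumNormalize v = v := by
  rw [sumNormalize, one_dotProduct, hv.2, inv_one, one_smul]

variable [DecidableEq n] {O : Matrix m n ℝ} {δ : n → ℝ}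

theorem one_dotProduct_col_mul_diagonal (hO : ∀ i, O.col i ∈ stdSimplex ℝ m) (i : n) :
    (1 : m → ℝ) ⬝ᵥ (O * diagonal δ).col i = δ i := by
  rw [col_mul_diagonal, dotProduct_smul, one_dotProduct, (hO i).2, smul_eq_mul, mul_one]

theorem sumNormalize_col_mul_diagonal (hO : ∀ i, O.col i ∈ stdSimplex ℝ m) (hδ : ∀ i, δ i ≠ 0) :
    (fun i => sumNormalize ((O * diagonal δ).col i)) = O.col := by
  ext1 i
  rw [col_mul_diagonal, sumNormalize_smul (hδ i), sumNormalize_of_mem_stdSimplex (hO i)]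

end SumNormalize

theorem output_eq_image {d k : ℕ} (W : Matrix (Fin d) (Fin k) ℝ) (L : Matrix (Fin k) (Fin k) ℝ)
    (s : Fin k → ℝ) :
    output W L s = (fun l => sumNormalize ((pinv W)ᵀ *ᵥ l)) '' uniqueSingularVectors L s :=
  rfl

/-- `A` is a canonical basis, with skewnesses `γ`, for a pair of a matrix `Pairs` and a family of
matrices `Triples`: its columns are linearly independent and diagonalize both simultaneously. This
is all that the algorithm needs to know about its input. -/
structure IsCanonicalBasis {d k : ℕ} (Pairs : Matrix (Fin d) (Fin d) ℝ)
    (Triples : (Fin d → ℝ) → Matrix (Fin d) (Fin d) ℝ) (A : Matrix (Fin d) (Fin k) ℝ)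
    (γ : Fin k → ℝ) : Prop where
  rank_eq : A.rank = k
  pairs_eq : Pairs = A * Aᵀ
  triples_eq : ∀ η, Triples η = A * diagonal (γ * (Aᵀ *ᵥ η)) * Aᵀ

namespace IsCanonicalBasis

variable {d k : ℕ} {Pairs : Matrix (Fin d) (Fin d) ℝ}
  {Triples : (Fin d → ℝ) → Matrix (Fin d) (Fin d) ℝ} {A U : Matrix (Fin d) (Fin k) ℝ}
  {V : Matrix (Fin k) (Fin k) ℝ} {γ : Fin k → ℝ}

theorem isReduction (hA : IsCanonicalBasis Pairs Triples A γ) : IsReduction Pairs A := by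
  rw [IsReduction, hA.pairs_eq, range_mulVecLin_mul_transpose_self]

theorem range_eq_of_isReduction (hA : IsCanonicalBasis Pairs Triples A γ)
    (hU : IsReduction Pairs U) :
    LinearMap.range U.mulVecLin = LinearMap.range A.mulVecLin :=
  hU.trans hA.isReduction.symm

theorem exists_isWhitening (hA : IsCanonicalBasis Pairs Triples A γ)
    (hU : IsReduction Pairs U) : ∃ V, IsWhitening Pairs U V := by
  rw [hA.pairs_eq]
  exact exists_isWhitening_mul_transpose <| isUnit_det_transpose_mul_of_range_eq
    (by rw [hA.rank_eq, Fintype.card_fin]) (hA.range_eq_of_isReduction hU)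

theorem transpose_mul_mem_orthogonalGroup (hA : IsCanonicalBasis Pairs Triples A γ)
    (hV : IsWhitening Pairs U V) : (U * V)ᵀ * A ∈ orthogonalGroup (Fin k) ℝ := by
  rw [mem_orthogonalGroup_iff, ← hV, hA.pairs_eq]
  simp only [transpose_mul, transpose_transpose, Matrix.mul_assoc]

theorem rank_mul_eq (hA : IsCanonicalBasis Pairs Triples A γ) (hV : IsWhitening Pairs U V) :
    (U * V).rank = k := by
  have orthogonal := (mem_orthogonalGroup_iff _ _).1 (hA.transpose_mul_mem_orthogonalGroup hV)
  refine le_antisymm (rank_le_width _) ?_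
  calc k = ((U * V)ᵀ * A).rank := by
        rw [rank_of_isUnit _ (IsUnit.of_mul_eq_one _ orthogonal), Fintype.card_fin]
    _ ≤ (U * V)ᵀ.rank := rank_mul_le_left _ _
    _ = (U * V).rank := rank_transpose _

theorem range_mul_eq (hA : IsCanonicalBasis Pairs Triples A γ) (hU : IsReduction Pairs U)
    (hV : IsWhitening Pairs U V) :
    LinearMap.range (U * V).mulVecLin = LinearMap.range A.mulVecLin := by
  refine Submodule.eq_of_le_of_finrank_eq ?_ ((hA.rank_mul_eq hV).trans hA.rank_eq.symm)
  rw [← hA.range_eq_of_isReduction hU, mulVecLin_mul]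
  exact LinearMap.range_comp_le_range _ _

theorem transpose_pinv_mulVec_col (hA : IsCanonicalBasis Pairs Triples A γ)
    (hU : IsReduction Pairs U) (hV : IsWhitening Pairs U V) (i : Fin k) :
    (pinv (U * V))ᵀ *ᵥ ((U * V)ᵀ * A).col i = A.col i := by
  rw [← mulVec_single_one, ← mulVec_mulVec, mulVec_single_one, mulVec_mulVec]
  refine transpose_pinv_mul_transpose_mulVec (hA.rank_mul_eq hV) ?_
  rw [hA.range_mul_eq hU hV]
  exact ⟨Pi.single i 1, mulVec_single_one A i⟩

theorem whitenedTriples_eq (hA : IsCanonicalBasis Pairs Triples A γ)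
    (W : Matrix (Fin d) (Fin k) ℝ) (θ : Fin k → ℝ) :
    whitenedTriples Triples W θ =
      (Wᵀ * A) * diagonal (γ * ((Wᵀ * A)ᵀ *ᵥ θ)) * (Wᵀ * A)ᵀ := by
  rw [whitenedTriples, hA.triples_eq, mulVec_mulVec]
  simp only [transpose_mul, transpose_transpose, Matrix.mul_assoc]

theorem exists_isSVD (hA : IsCanonicalBasis Pairs Triples A γ) (hV : IsWhitening Pairs U V)
    (θ : Fin k → ℝ) : ∃ L s R, IsSVD (whitenedTriples Triples (U * V) θ) L s R := by
  rw [hA.whitenedTriples_eq]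
  exact exists_isSVD_of_orthogonal (hA.transpose_mul_mem_orthogonalGroup hV) _

variable {L R : Matrix (Fin k) (Fin k) ℝ} {s θ : Fin k → ℝ}

theorem exists_transpose_pinv_mulVec_eq_smul (hA : IsCanonicalBasis Pairs Triples A γ)
    (hU : IsReduction Pairs U) (hV : IsWhitening Pairs U V)
    (hs : IsSVD (whitenedTriples Triples (U * V) θ) L s R) {l : Fin k → ℝ}
    (hl : l ∈ uniqueSingularVectors L s) :
    ∃ i, ∃ c : ℝ, c ≠ 0 ∧ (pinv (U * V))ᵀ *ᵥ l = c • A.col i := by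
  obtain ⟨j, rfl, hj⟩ := hl
  rw [hA.whitenedTriples_eq] at hs
  obtain ⟨i, c, hc, hcol, -⟩ :=
    hs.exists_col_eq_smul (hA.transpose_mul_mem_orthogonalGroup hV) hj
  exact ⟨i, c, hc, by rw [hcol, mulVec_smul, hA.transpose_pinv_mulVec_col hU hV]⟩

theorem one_dotProduct_ne_zero (hA : IsCanonicalBasis Pairs Triples A γ)
    (hU : IsReduction Pairs U) (hV : IsWhitening Pairs U V)
    (hs : IsSVD (whitenedTriples Triples (U * V) θ) L s R)
    (hsum : ∀ i, (1 : Fin d → ℝ) ⬝ᵥ A.col i ≠ 0) {l : Fin k → ℝ}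
    (hl : l ∈ uniqueSingularVectors L s) :
    (1 : Fin d → ℝ) ⬝ᵥ ((pinv (U * V))ᵀ *ᵥ l) ≠ 0 := by
  obtain ⟨i, c, hc, hcl⟩ := hA.exists_transpose_pinv_mulVec_eq_smul hU hV hs hl
  rw [hcl, dotProduct_smul]
  exact mul_ne_zero hc (hsum i)

theorem output_subset (hA : IsCanonicalBasis Pairs Triples A γ) (hU : IsReduction Pairs U)
    (hV : IsWhitening Pairs U V) (hs : IsSVD (whitenedTriples Triples (U * V) θ) L s R) :
    output (U * V) L s ⊆ Set.range fun i => sumNormalize (A.col i) := by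
  rw [output_eq_image]
  rintro _ ⟨l, hl, rfl⟩
  obtain ⟨i, c, hc, hcl⟩ := hA.exists_transpose_pinv_mulVec_eq_smul hU hV hs hl
  exact ⟨i, by simp only [hcl, sumNormalize_smul hc]⟩

theorem subset_output (hA : IsCanonicalBasis Pairs Triples A γ) (hU : IsReduction Pairs U)
    (hV : IsWhitening Pairs U V) (hs : IsSVD (whitenedTriples Triples (U * V) θ) L s R)
    (hθ : Function.Injective fun i => (γ * (((U * V)ᵀ * A)ᵀ *ᵥ θ)) i ^ 2) :
    (Set.range fun i => sumNormalize (A.col i)) ⊆ output (U * V) L s := by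
  rw [output_eq_image]
  rintro _ ⟨i, rfl⟩
  rw [hA.whitenedTriples_eq] at hs
  obtain ⟨j, hj, c, hc, hcol⟩ :=
    hs.exists_unique_col_eq_smul (hA.transpose_mul_mem_orthogonalGroup hV) hθ i
  exact ⟨L.col j, ⟨j, rfl, hj⟩, by
    simp only [hcol, mulVec_smul, hA.transpose_pinv_mulVec_col hU hV, sumNormalize_smul hc]⟩

theorem ae_injective_sq (hA : IsCanonicalBasis Pairs Triples A γ) (hγ : ∀ i, γ i ≠ 0)
    (hV : IsWhitening Pairs U V) :
    ∀ᵐ θ ∂uniformSphere k,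
      Function.Injective fun i => (γ * (((U * V)ᵀ * A)ᵀ *ᵥ θ.1.ofLp)) i ^ 2 := by
  have isUnit_diagonal : IsUnit (diagonal γ) := by
    rw [isUnit_diagonal, Pi.isUnit_iff]
    exact fun i => (hγ i).isUnit
  have isUnit_transpose : IsUnit ((U * V)ᵀ * A)ᵀ := IsUnit.of_mul_eq_one _
    ((mem_orthogonalGroup_iff' _ _).1 (hA.transpose_mul_mem_orthogonalGroup hV))
  filter_upwards [ae_uniformSphere_injective_sq_mulVec
    (linearIndependent_rows_of_isUnit (isUnit_diagonal.mul isUnit_transpose))] with θ hθ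
  simpa only [← mulVec_mulVec, mulVec_diagonal, Pi.mul_apply] using hθ

theorem ae_output_eq (hA : IsCanonicalBasis Pairs Triples A γ) (hγ : ∀ i, γ i ≠ 0)
    (hU : IsReduction Pairs U) (hV : IsWhitening Pairs U V) :
    ∀ᵐ θ ∂uniformSphere k, ∀ L s R,
      IsSVD (whitenedTriples Triples (U * V) θ.1.ofLp) L s R →
        output (U * V) L s = Set.range fun i => sumNormalize (A.col i) := by
  filter_upwards [hA.ae_injective_sq hγ hV] with θ hθ L s R hs
  exact (hA.output_subset hU hV hs).antisymm (hA.subset_output hU hV hs hθ)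

end IsCanonicalBasis

section CanonicalBasisOfModel

variable {d k : ℕ} {O : Matrix (Fin d) (Fin k) ℝ} {δ : Fin k → ℝ}

theorem isCanonicalBasis_mul_diagonal {Pairs : Matrix (Fin d) (Fin d) ℝ}
    {Triples : (Fin d → ℝ) → Matrix (Fin d) (Fin d) ℝ} {γ : Fin k → ℝ} (hO : O.rank = k)
    (hδ : ∀ i, δ i ≠ 0) (hPairs : Pairs = O * diagonal (δ ^ 2) * Oᵀ)
    (hTriples : ∀ η, Triples η = O * diagonal (γ * δ ^ 3 * (Oᵀ *ᵥ η)) * Oᵀ) :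
    IsCanonicalBasis Pairs Triples (O * diagonal δ) γ where
  rank_eq := by
    rw [rank_mul_eq_left_of_isUnit_det, hO]
    rw [det_diagonal]
    exact (Finset.prod_ne_zero_iff.2 fun i _ => hδ i).isUnit
  pairs_eq := by
    rw [hPairs, ← diagonal_pow, sq]
    simp only [transpose_mul, diagonal_transpose, Matrix.mul_assoc]
  triples_eq η := by
    have diagonal_eq : diagonal (γ * δ ^ 3 * (Oᵀ *ᵥ η)) =
        diagonal δ * diagonal (γ * ((O * diagonal δ)ᵀ *ᵥ η)) * diagonal δ := by
      rw [diagonal_mul_diagonal, diagonal_mul_diagonal, transpose_mul, diagonal_transpose,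
        ← mulVec_mulVec]
      congr 1 with i
      simp only [Pi.mul_apply, Pi.pow_apply, mulVec_diagonal]
      ring
    rw [hTriples, diagonal_eq]
    simp only [transpose_mul, diagonal_transpose, Matrix.mul_assoc]

variable {Ω : Type*} [MeasurableSpace Ω] {P : Measure Ω} {α : Fin k → ℝ}
  {h : Ω → Fin k → ℝ} {z : ℕ → Ω → Fin k} {w : ℕ → Ω → Fin d}

theorem IsModel.exists_isCanonicalBasis [IsFiniteMeasure P] (hm : IsModel P α O h z w)
    (hα : ∀ i, 0 < α i) (hO : ∀ a i, 0 ≤ O a i) (hrank : O.rank = k) :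
    ∃ δ γ : Fin k → ℝ, (∀ i, δ i ≠ 0) ∧ (∀ i, γ i ≠ 0) ∧
      IsCanonicalBasis (pairs P (oneHot w) (∑ i, α i)) (triples P (oneHot w) (∑ i, α i))
        (O * diagonal δ) γ := by
  set α₀ := ∑ i, α i
  have hα₀ (i : Fin k) : 0 < α₀ := Finset.sum_pos (fun i _ => hα i) ⟨i, Finset.mem_univ i⟩
  have hvar (i : Fin k) : 0 < α i / (α₀ * (α₀ + 1)) := by
    have := hα i
    have := hα₀ i
    positivity
  set δ : Fin k → ℝ := fun i => √(α i / (α₀ * (α₀ + 1)))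
  have hδ (i : Fin k) : 0 < δ i := Real.sqrt_pos.2 (hvar i)
  have δ_sq : δ ^ 2 = fun i => α i / (α₀ * (α₀ + 1)) := funext fun i => Real.sq_sqrt (hvar i).le
  refine ⟨δ, fun i => 2 / ((α₀ + 2) * δ i), fun i => (hδ i).ne', fun i => ?_,
    isCanonicalBasis_mul_diagonal hrank (fun i => (hδ i).ne') ?_ fun η => ?_⟩
  · have := hα₀ i
    have := hδ i
    positivity
  · rw [hm.pairs_eq hα hO, δ_sq]
  · rw [hm.triples_eq hα hO]
    congr 3 with i
    have := hα₀ i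
    have := hδ i
    have δ_sq_apply : δ i ^ 2 = α i / (α₀ * (α₀ + 1)) := congrFun δ_sq i
    calc 2 * α i * (Oᵀ *ᵥ η) i / (α₀ * (α₀ + 1) * (α₀ + 2))
        = 2 / (α₀ + 2) * (α i / (α₀ * (α₀ + 1))) * (Oᵀ *ᵥ η) i := by field_simp
      _ = 2 / ((α₀ + 2) * δ i) * δ i ^ 3 * (Oᵀ *ᵥ η) i := by rw [← δ_sq_apply]; field_simp

theorem IsModel.eq_smul_pinv_mul_pairs_mul_transpose_pinv_mulVec_one (hm : IsModel P α O h z w)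
    (hα : ∀ i, 0 < α i) (hO : ∀ a i, 0 ≤ O a i) (hrank : O.rank = k) :
    α = ((∑ i, α i) * (∑ i, α i + 1)) •
      ((pinv O * pairs P (oneHot w) (∑ i, α i) * (pinv O)ᵀ) *ᵥ (1 : Fin k → ℝ)) := by
  rw [hm.pairs_eq hα hO, pinv_mul_mul_mul_transpose_pinv hrank]
  ext i
  have hα₀ : 0 < ∑ i, α i := Finset.sum_pos (fun i _ => hα i) ⟨i, Finset.mem_univ i⟩
  rw [Pi.smul_apply, mulVec_diagonal, Pi.one_apply, mul_one, smul_eq_mul,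
    mul_div_cancel₀ _ (by positivity)]

end CanonicalBasisOfModel

end LDA

theorem theorem3 {Ω : Type*} [MeasurableSpace Ω] (P : Measure Ω) [IsProbabilityMeasure P]
    {d k : ℕ} (α : Fin k → ℝ) (hα : ∀ i, 0 < α i) (α₀ : ℝ) (hα₀ : α₀ = ∑ i, α i)
    (O : Matrix (Fin d) (Fin k) ℝ) (hO : ∀ i, O.col i ∈ stdSimplex ℝ (Fin d))
    (hrank : O.rank = k)
    (h : Ω → Fin k → ℝ) (z : ℕ → Ω → Fin k) (w : ℕ → Ω → Fin d)
    (hmodel : LDA.IsModel P α O h z w)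
    (Pairs : Matrix (Fin d) (Fin d) ℝ) (hPairs : Pairs = LDA.pairs P (LDA.oneHot w) α₀)
    (Triples : (Fin d → ℝ) → Matrix (Fin d) (Fin d) ℝ)
    (hTriples : Triples = LDA.triples P (LDA.oneHot w) α₀) :
    -- every step of the algorithm can be carried out
    ((∃ U : Matrix (Fin d) (Fin k) ℝ, LDA.IsReduction Pairs U) ∧
      ∀ U : Matrix (Fin d) (Fin k) ℝ, LDA.IsReduction Pairs U →
        (∃ V, LDA.IsWhitening Pairs U V) ∧
        ∀ V, LDA.IsWhitening Pairs U V →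
          IsUnit ((U * V)ᵀ * (U * V)).det ∧
          ∀ θ : Fin k → ℝ,
            (∃ L s R, LDA.IsSVD (LDA.whitenedTriples Triples (U * V) θ) L s R) ∧
            ∀ L s R, LDA.IsSVD (LDA.whitenedTriples Triples (U * V) θ) L s R →
              ∀ l ∈ LDA.uniqueSingularVectors L s,
                (1 : Fin d → ℝ) ⬝ᵥ ((LDA.pinv (U * V))ᵀ *ᵥ l) ≠ 0) ∧
    -- no false positives
    (∀ (U : Matrix (Fin d) (Fin k) ℝ) (V : Matrix (Fin k) (Fin k) ℝ),
      LDA.IsReduction Pairs U → LDA.IsWhitening Pairs U V →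
        ∀ θ : Fin k → ℝ, ∀ L s R,
          LDA.IsSVD (LDA.whitenedTriples Triples (U * V) θ) L s R →
            LDA.output (U * V) L s ⊆ Set.range O.col) ∧
    -- topic recovery
    (∀ (U : Matrix (Fin d) (Fin k) ℝ) (V : Matrix (Fin k) (Fin k) ℝ),
      LDA.IsReduction Pairs U → LDA.IsWhitening Pairs U V →
        ∀ᵐ θ ∂(LDA.uniformSphere k), ∀ L s R,
          LDA.IsSVD (LDA.whitenedTriples Triples (U * V) θ.1.ofLp) L s R →
            LDA.output (U * V) L s = Set.range O.col) ∧
    -- parameter recovery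
    α = (α₀ * (α₀ + 1)) • ((LDA.pinv O * Pairs * (LDA.pinv O)ᵀ) *ᵥ (1 : Fin k → ℝ)) := by
  subst hα₀ hPairs hTriples
  have hO₀ (a : Fin d) (i : Fin k) : 0 ≤ O a i := (hO i).1 a
  obtain ⟨δ, γ, hδ, hγ, hA⟩ := hmodel.exists_isCanonicalBasis hα hO₀ hrank
  have cols_eq := LDA.sumNormalize_col_mul_diagonal hO hδ
  refine ⟨⟨⟨_, hA.isReduction⟩, fun U hU => ⟨hA.exists_isWhitening hU, fun V hV =>
    ⟨LDA.isUnit_det_transpose_mul_self (hA.rank_mul_eq hV), fun θ =>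
      ⟨hA.exists_isSVD hV θ, fun L s R hs l hl => hA.one_dotProduct_ne_zero hU hV hs ?_ hl⟩⟩⟩⟩,
    fun U V hU hV θ L s R hs => cols_eq ▸ hA.output_subset hU hV hs,
    fun U V hU hV => cols_eq ▸ hA.ae_output_eq hγ hU hV,
    hmodel.eq_smul_pinv_mul_pairs_mul_transpose_pinv_mulVec_one hα hO₀ hrank⟩
  intro i
  rw [LDA.one_dotProduct_col_mul_diagonal hO]
  exact hδ i
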